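/- Let $T$ be a (finite or countable) locally finite tree with edge set $E$, with a marked pre-root vertex $o^*$ having exactly one neighbour, the root $o$; let $\omega$ be the edge joining $o^*$ and $o$. Let $\partial T$ be the set of maximal geodesics emanating from $o^*$, where a finite maximal geodesic is identified with the leaf at which it ends, and let $\overline T=T\cup\partial T$. For $x\in\overline T$ let $[o^*,x]\subseteq E$ be the set of edges of the geodesic from $o^*$ to $x$. For $\alpha\in E$ let $b(\alpha)$ and $e(\alpha)$ be its endpoints closest to and furthest from $o^*$, let $d(\alpha)$ be the graph distance from $o^*$ to $b(\alpha)$ (so $d(\omega)=0$), and let $S(\alpha)=\{x\in\overline T:\alpha\in[o^*,x]\}$; write $\beta\subseteq\alpha$ if $\alpha\in[o^*,e(\beta)]$. Equip $\overline T$ with the topology generated by the sets $S(\alpha)$, $\alpha\in E$, and the singletons $\{x\}$, $x\in T$. Let $1<p<\infty$, $p^*=p/(p-1)$, let $\pi:E\to(0,\infty)$ be a weight and let $\mu\ge 0$ be a finite Borel measure on $\overline T$. Let $\ell^p(\pi)$ be the space of $\varphi:E\to\mathbb R$ with $\sum_{\alpha\in E}|\varphi(\alpha)|^p\pi(\alpha)<\infty$,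 and let $L^p(\mu)=L^p(\overline T,\mu)$. The Hardy operator is $$\mathcal I\varphi(x)=\sum_{\alpha\in[o^*,x]}\varphi(\alpha),\qquad x\in\overline T .$$ Then $\mathcal I$ is a well-defined compact linear operator $\ell^p(\pi)\to L^p(\mu)$ (that is, for every $\varphi\in\ell^p(\pi)$ the sum converges absolutely for $\mu$-almost every $x$, $\mathcal I\varphi\in L^p(\mu)$, and the resulting linear operator is compact) if and only if $$\lim_{n\to\infty}\ \sup_{\alpha\in E,\ d(\alpha)\ge n}\ \frac{\sum_{\beta\subseteq\alpha}\pi(\beta)^{1-p^*}\mu(S(\beta))^{p^*}}{\mu(S(\alpha))}=0 ,$$ where the ratio takes values in $[0,\infty]$, is read as $0$ when $\mu(S(\alpha))=0$, and the supremum over the empty set is $0$. -/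

import Mathlib

open MeasureTheory Filter Topology
open scoped ENNReal

noncomputable section

/-- A locally finite tree with vertex set `V`, with a marked pre-root `o*` whose only neighbour
is the root `o`. -/
structure PreRootedTree (V : Type*) where
  graph : SimpleGraph V
  isTree : graph.IsTree
  locallyFinite : ∀ v, (graph.neighborSet v).Finite
  preRoot : V
  root : V
  adj_preRoot_iff : ∀ v, graph.Adj preRoot v ↔ v = root

namespace PreRootedTree

variable {V : Type*} (T : PreRootedTree V)

/-- The set `E` of (undirected) edges. -/
def Edge : Type _ := T.graph.edgeSet

/-- The two endpoints of an edge, as an unordered pair. -/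
def Edge.ends {T : PreRootedTree V} (α : T.Edge) : Sym2 V := α.1

theorem Edge.exists_far {T : PreRootedTree V} (α : T.Edge) :
    ∃ x ∈ α.ends, ∀ y ∈ α.ends, T.graph.dist T.preRoot y ≤ T.graph.dist T.preRoot x := by
  induction h : α.ends with
  | _ u v =>
    rcases le_total (T.graph.dist T.preRoot u) (T.graph.dist T.preRoot v) with h | h
    · exact ⟨v, by simp, by simp [h]⟩
    · exact ⟨u, by simp, by simp [h]⟩

theorem Edge.exists_near {T : PreRootedTree V} (α : T.Edge) :
    ∃ x ∈ α.ends, ∀ y ∈ α.ends, T.graph.dist T.preRoot x ≤ T.graph.dist T.preRoot y := by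
  induction h : α.ends with
  | _ u v =>
    rcases le_total (T.graph.dist T.preRoot u) (T.graph.dist T.preRoot v) with h | h
    · exact ⟨u, by simp, by simp [h]⟩
    · exact ⟨v, by simp, by simp [h]⟩

/-- `e(α)`: the endpoint of `α` furthest from the pre-root. -/
def Edge.far {T : PreRootedTree V} (α : T.Edge) : V := α.exists_far.choose

/-- `b(α)`: the endpoint of `α` closest to the pre-root. -/
def Edge.near {T : PreRootedTree V} (α : T.Edge) : V := α.exists_near.choose

/-- `d(α)`: the number of vertices separating `α` from the root edge `ω`, so that `d(ω) = 0`.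
These are the vertices other than `o*` on the path from `o*` to `b(α)`. -/
def Edge.depth {T : PreRootedTree V} (α : T.Edge) : ℕ := T.graph.dist T.preRoot α.near

/-- The infinite geodesics emanating from the pre-root (infinite simple paths, which are the
infinite geodesics because the graph is a tree). -/
structure Ray where
  toFun : ℕ → V
  start : toFun 0 = T.preRoot
  adj : ∀ n, T.graph.Adj (toFun n) (toFun (n + 1))
  injective : Function.Injective toFun

/-- The standard compactification `T ∪ ∂T`. Finite maximal geodesics are identified with the leaf
where they end, so the new points are the infinite geodesics. -/
inductive Compactification
  | vertex (v : V)
  | boundary (ζ : T.Ray)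

/-- `[o*, x]`: the set of edges of the geodesic from the pre-root to the vertex or boundary
point `x`. -/
def segment : T.Compactification → Set T.Edge
  | .vertex v => {α | ∃ w : T.graph.Walk T.preRoot v, w.IsPath ∧ α.ends ∈ w.edges}
  | .boundary ζ => {α | ∃ n, α.ends = s(ζ.toFun n, ζ.toFun (n + 1))}

/-- The successor set `S(α) = {x : α ∈ [o*, x]}`. -/
def succSet (α : T.Edge) : Set T.Compactification := {x | α ∈ T.segment x}

/-- The edges `β ⊆ α`, that is, the edges `β` with `α ∈ [o*, e(β)]`. -/
def edgesBelow (α : T.Edge) : Set T.Edge := {β | α ∈ T.segment (.vertex β.far)}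

/-- The topology generated by the successor sets and the singletons of vertices. -/
instance : TopologicalSpace T.Compactification :=
  TopologicalSpace.generateFrom
    (Set.range T.succSet ∪ Set.range fun v : V => {Compactification.vertex v})

instance : MeasurableSpace T.Compactification := borel _

instance : BorelSpace T.Compactification := ⟨rfl⟩

instance : MeasurableSpace T.Edge := ⊤

instance : DiscreteMeasurableSpace T.Edge := ⟨fun _ => trivial⟩

/-- The measure on `E` giving mass `π α` to the edge `α`; `ℓ^p(π)` is its `L^p` space. -/
def edgeMeasure (π : T.Edge → ℝ) : Measure T.Edge :=
  Measure.count.withDensity fun α => ENNReal.ofReal (π α)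

instance factOneLeOfReal {p : ℝ} [hp : Fact (1 < p)] : Fact (1 ≤ ENNReal.ofReal p) :=
  ⟨ENNReal.one_le_ofReal.2 hp.out.le⟩

/-- The map `φ ↦ 𝓘φ`, `𝓘φ(x) = ∑_{α ∈ [o*, x]} φ(α)`, is a well-defined compact linear operator
from `ℓ^p(π)` to `L^p(μ)`: for every `φ ∈ ℓ^p(π)` the sum converges at `μ`-almost every `x`
and defines an element of `L^p(μ)`, and the resulting operator is compact. -/
def IsCompactHardyOperator (p : ℝ) [Fact (1 < p)] (π : T.Edge → ℝ)
    (μ : Measure T.Compactification) : Prop :=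
  ∃ K : Lp ℝ (ENNReal.ofReal p) (T.edgeMeasure π) →L[ℝ] Lp ℝ (ENNReal.ofReal p) μ,
    (∀ φ, ∀ᵐ x ∂μ, HasSum (fun α : T.segment x => φ α.1) (K φ x)) ∧ IsCompactOperator K

/-- The energy-mass ratio
`(∑_{β ⊆ α} π(β)^{1-p*} μ(S(β))^{p*}) / μ(S(α))`, with `p* = p / (p - 1)`, in `[0, ∞]`
(where `0 / 0 = 0`). -/
def energyMassRatio (p : ℝ) (π : T.Edge → ℝ) (μ : Measure T.Compactification) (α : T.Edge) :
    ℝ≥0∞ :=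
  (∑' β : T.edgesBelow α,
      ENNReal.ofReal (π β.1 ^ (1 - p.conjExponent)) * μ (T.succSet β.1) ^ p.conjExponent)
    / μ (T.succSet α)

end PreRootedTree

end

/-!
Compactness of the Hardy operator on a rooted tree is equivalent to the vanishing of the
energy-mass ratios `(∑_{β ⊆ α} π(β)^{1-p*} μ(S(β))^{p*}) / μ(S(α))` at infinite depth. Write `q` for
the conjugate exponent `p*`.

*Sufficiency.* The operator is the sum over the edges of the rank-one operators
`φ ↦ φ(α) 1_{S(α)}`. The trace inequality `integral_hardySum_rpow_le` shows that if all ratios at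
the edges of a finite set `F` are at most `ε`, then the part of the sum over `F` has norm at most
`p ε^{1/q}`. Only finitely many edges have depth less than `n`, so the sum converges in operator
norm, to a compact operator; almost everywhere convergence of the pointwise series follows from
monotonicity applied to `|φ|` (`ae_hasSum_of_hasSum_edgeCLM`).

The trace inequality has an elementary proof, without maximal functions or duality. Let
`u(x) = ∑_{α ∈ F ∩ [o*, x]} φ(α)` with `φ ≥ 0`, put `u_γ = u(e(γ))` and
`δ_γ = u_γ ^ p - (u_γ - φ(γ)) ^ p`. Geodesics from the pre-root are chains, so
`u ^ p = ∑_γ δ_γ 1_{S(γ)}` by telescoping. By `δ_γ ≤ p φ(γ) u_γ ^ (p - 1)` and Hölder's inequality,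
`X = ∫ u ^ p dμ` is at most `p ‖φ‖ (∑_α a(α) u_α ^ p)^{1/q}` with `a = π^{1-q} μ(S)^q`. Expanding
`u_α ^ p` into the increments `δ_γ` once more and exchanging the sums, the last sum is at most
`ε ∑_γ δ_γ μ(S(γ)) = ε X`. Hence `X^{1/p} ≤ p ε^{1/q} ‖φ‖`.

*Necessity.* Since `p > 1`, normalised disjointly supported functions in `ℓ^p(π)` have averages
tending to zero, so a compact operator is small on finitely supported functions living outside a
large finite set of edges (`exists_finset_norm_apply_le`). Testing this on the extremal functions
`(μ(S(α)) / π(α))^{q-1}`, restricted to finite sets of edges below `γ`, bounds the ratio at `γ`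
(`sum_energy_le_of_norm_apply_le`).
-/

namespace PreRootedTree

variable {V : Type*} {T : PreRootedTree V}

/-! ### Geodesics and the order on edges -/

instance [Countable V] : Countable T.Edge := by
  unfold Edge; infer_instance

/-- In a tree every path is a geodesic. -/
theorem length_eq_dist_of_isPath {u v : V} {w : T.graph.Walk u v} (hw : w.IsPath) :
    w.length = T.graph.dist u v := by
  obtain ⟨q, hq, hl⟩ := T.isTree.connected.exists_path_of_dist u v
  rw [← hl, (T.isTree.existsUnique_path u v).unique hw hq]

theorem dist_getVert_of_isPath {u v : V} {w : T.graph.Walk u v} (hw : w.IsPath) {k : ℕ}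
    (hk : k ≤ w.length) : T.graph.dist u (w.getVert k) = k := by
  rw [← length_eq_dist_of_isPath (hw.take k), SimpleGraph.Walk.take_length, min_eq_left hk]

theorem exists_isPath (T : PreRootedTree V) (v : V) :
    ∃ w : T.graph.Walk T.preRoot v, w.IsPath :=
  (T.isTree.existsUnique_path T.preRoot v).exists

/-- If the endpoints of an edge are at different distances from the pre-root, then these
distances identify `near` and `far`. -/
theorem Edge.near_far_eq {α : T.Edge} {u v : V} (h : α.ends = s(u, v))
    (hd : T.graph.dist T.preRoot u < T.graph.dist T.preRoot v) : α.near = u ∧ α.far = v := by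
  obtain ⟨hn, hn'⟩ := α.exists_near.choose_spec
  obtain ⟨hf, hf'⟩ := α.exists_far.choose_spec
  change α.near ∈ _ at hn
  change α.far ∈ _ at hf
  change ∀ y ∈ _, T.graph.dist T.preRoot α.near ≤ _ at hn'
  change ∀ y ∈ _, _ ≤ T.graph.dist T.preRoot α.far at hf'
  simp only [h, Sym2.mem_iff, forall_eq_or_imp, forall_eq] at hn hf hn' hf'
  constructor
  · rcases hn with h | h
    · exact h
    · rw [h] at hn'; omega
  · rcases hf with h | h
    · rw [h] at hf'; omega
    · exact h

theorem Edge.exists_ends (α : T.Edge) : ∃ u v, α.ends = s(u, v) ∧ T.graph.Adj u v ∧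
    T.graph.dist T.preRoot v = T.graph.dist T.preRoot u + 1 := by
  obtain ⟨e, he⟩ := α
  induction e with
  | _ u v =>
    have had : T.graph.Adj u v := he
    rcases T.isTree.dist_eq_dist_add_one_of_adj T.preRoot had with h | h
    · exact ⟨v, u, Sym2.eq_swap, had.symm, h⟩
    · exact ⟨u, v, rfl, had, h⟩

theorem Edge.ends_eq (α : T.Edge) : α.ends = s(α.near, α.far) := by
  obtain ⟨u, v, h, -, hd⟩ := α.exists_ends
  obtain ⟨h1, h2⟩ := Edge.near_far_eq h (by omega)
  rw [h1, h2, h]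

theorem Edge.adj (α : T.Edge) : T.graph.Adj α.near α.far := by
  obtain ⟨u, v, h, had, hd⟩ := α.exists_ends
  obtain ⟨h1, h2⟩ := Edge.near_far_eq h (by omega)
  rwa [h1, h2]

theorem Edge.dist_far (α : T.Edge) : T.graph.dist T.preRoot α.far = α.depth + 1 := by
  obtain ⟨u, v, h, had, hd⟩ := α.exists_ends
  obtain ⟨h1, h2⟩ := Edge.near_far_eq h (by omega)
  rw [Edge.depth, h1, h2, hd]

theorem Edge.ext_of_ends {α β : T.Edge} (h : α.ends = β.ends) : α = β := Subtype.ext h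

/-- The edges of a path from the pre-root, described by their position on it. -/
theorem mem_edges_iff_of_isPath {v : V} {w : T.graph.Walk T.preRoot v} (hw : w.IsPath)
    (α : T.Edge) : α.ends ∈ w.edges ↔ α.depth < w.length ∧
      α.near = w.getVert α.depth ∧ α.far = w.getVert (α.depth + 1) := by
  constructor
  · intro h
    rw [α.ends_eq, SimpleGraph.Walk.mk_mem_edges_iff_exists] at h
    obtain ⟨i, hi, he⟩ := h
    have h1 := dist_getVert_of_isPath hw hi.le
    have h2 := dist_getVert_of_isPath hw (k := i + 1) hi
    obtain ⟨h3, h4⟩ := Edge.near_far_eq (α := α) (α.ends_eq.trans he.symm) (by omega)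
    have hd : α.depth = i := by rw [Edge.depth, h3, h1]
    rw [hd]
    exact ⟨hi, h3, h4⟩
  · rintro ⟨h1, h2, h3⟩
    rw [α.ends_eq, SimpleGraph.Walk.mk_mem_edges_iff_exists]
    exact ⟨α.depth, h1, by rw [h2, h3]⟩

theorem mem_segment_vertex_iff {v : V} {w : T.graph.Walk T.preRoot v} (hw : w.IsPath)
    (α : T.Edge) : α ∈ T.segment (.vertex v) ↔ α.ends ∈ w.edges := by
  constructor
  · rintro ⟨w', hw', h⟩
    rwa [(T.isTree.existsUnique_path _ _).unique hw hw']
  · exact fun h => ⟨w, hw, h⟩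

/-- The edges of the geodesic to a point of a ray are the edges of the ray before that point. -/
theorem mem_segment_ray_vertex_iff (ζ : T.Ray) (m : ℕ) (α : T.Edge) :
    α ∈ T.segment (.vertex (ζ.toFun m)) ↔ ∃ i < m, α.ends = s(ζ.toFun i, ζ.toFun (i + 1)) := by
  have key : ∃ w : T.graph.Walk T.preRoot (ζ.toFun m), w.IsPath ∧
      (∀ v ∈ w.support, ∃ i ≤ m, v = ζ.toFun i) ∧
      ∀ e, e ∈ w.edges ↔ ∃ i < m, e = s(ζ.toFun i, ζ.toFun (i + 1)) := by
    induction m with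
    | zero =>
      refine ⟨SimpleGraph.Walk.nil.copy rfl ζ.start.symm, by simp, ?_, by simp⟩
      intro v hv
      exact ⟨0, le_rfl, by simpa [ζ.start] using hv⟩
    | succ m ih =>
      obtain ⟨w, hw, hs, he⟩ := ih
      refine ⟨w.concat (ζ.adj m), hw.concat ?_ _, ?_, ?_⟩
      · intro hmem
        obtain ⟨i, hi, h⟩ := hs _ hmem
        have := ζ.injective h
        omega
      · intro v hv
        rw [SimpleGraph.Walk.support_concat, List.mem_append] at hv
        rcases hv with hv | hv
        · obtain ⟨i, hi, h⟩ := hs _ hv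
          exact ⟨i, by omega, h⟩
        · exact ⟨m + 1, le_rfl, by simpa using hv⟩
      · intro e
        rw [SimpleGraph.Walk.edges_concat, List.concat_eq_append, List.mem_append, he]
        simp only [List.mem_singleton]
        constructor
        · rintro (⟨i, hi, h⟩ | h)
          · exact ⟨i, by omega, h⟩
          · exact ⟨m, by omega, h⟩
        · rintro ⟨i, hi, h⟩
          rcases Nat.lt_succ_iff_lt_or_eq.1 hi with hi | rfl
          · exact Or.inl ⟨i, hi, h⟩
          · exact Or.inr h
  obtain ⟨w, hw, -, he⟩ := key
  rw [mem_segment_vertex_iff hw, he]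

/-- Any two edges of a geodesic already lie on the geodesic to one of its vertices. -/
theorem exists_vertex_segment_subset {x : T.Compactification} {α β : T.Edge}
    (hα : α ∈ T.segment x) (hβ : β ∈ T.segment x) :
    ∃ v, α ∈ T.segment (.vertex v) ∧ β ∈ T.segment (.vertex v) ∧
      T.segment (.vertex v) ⊆ T.segment x := by
  cases x with
  | vertex v => exact ⟨v, hα, hβ, subset_rfl⟩
  | boundary ζ =>
    obtain ⟨i, hi⟩ := hα
    obtain ⟨j, hj⟩ := hβ
    refine ⟨ζ.toFun (i + j + 1), ?_, ?_, ?_⟩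
    · exact (mem_segment_ray_vertex_iff _ _ _).2 ⟨i, by omega, hi⟩
    · exact (mem_segment_ray_vertex_iff _ _ _).2 ⟨j, by omega, hj⟩
    · intro γ hγ
      obtain ⟨k, -, hk⟩ := (mem_segment_ray_vertex_iff _ _ _).1 hγ
      exact ⟨k, hk⟩

theorem mem_segment_far_iff_of_vertex {v : V} {α γ : T.Edge} (hα : α ∈ T.segment (.vertex v)) :
    γ ∈ T.segment (.vertex α.far) ↔ γ ∈ T.segment (.vertex v) ∧ γ.depth ≤ α.depth := by
  obtain ⟨w, hw⟩ := T.exists_isPath v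
  rw [mem_segment_vertex_iff hw, mem_edges_iff_of_isPath hw] at hα
  obtain ⟨hα1, hα2, hα3⟩ := hα
  rw [mem_segment_vertex_iff hw, mem_edges_iff_of_isPath hw, hα3,
    mem_segment_vertex_iff (hw.take _), mem_edges_iff_of_isPath (hw.take _)]
  simp only [SimpleGraph.Walk.take_length, SimpleGraph.Walk.take_getVert]
  constructor
  · rintro ⟨h1, h2, h3⟩
    rw [min_eq_right (by omega)] at h2 h3
    exact ⟨⟨by omega, h2, h3⟩, by omega⟩
  · rintro ⟨⟨h1, h2, h3⟩, h4⟩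
    rw [min_eq_right (a := α.depth + 1) (b := γ.depth) (by omega),
      min_eq_right (a := α.depth + 1) (b := γ.depth + 1) (by omega)]
    exact ⟨by omega, h2, h3⟩

/-- A geodesic through `α` begins with the geodesic to `e(α)`: on it, lying above `α` is the same
as having smaller depth. -/
theorem mem_segment_far_iff {x : T.Compactification} {α γ : T.Edge} (hα : α ∈ T.segment x) :
    γ ∈ T.segment (.vertex α.far) ↔ γ ∈ T.segment x ∧ γ.depth ≤ α.depth := by
  constructor
  · intro h
    obtain ⟨v, h1, -, h3⟩ := exists_vertex_segment_subset hα hα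
    obtain ⟨h4, h5⟩ := (mem_segment_far_iff_of_vertex h1).1 h
    exact ⟨h3 h4, h5⟩
  · rintro ⟨h1, h2⟩
    obtain ⟨v, h3, h4, -⟩ := exists_vertex_segment_subset hα h1
    exact (mem_segment_far_iff_of_vertex h3).2 ⟨h4, h2⟩

theorem depth_injOn_segment (x : T.Compactification) : Set.InjOn Edge.depth (T.segment x) := by
  intro α hα β hβ h
  obtain ⟨v, h1, h2, -⟩ := exists_vertex_segment_subset hα hβ
  obtain ⟨w, hw⟩ := T.exists_isPath v
  rw [mem_segment_vertex_iff hw, mem_edges_iff_of_isPath hw] at h1 h2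
  apply Edge.ext_of_ends
  rw [α.ends_eq, β.ends_eq, h1.2.1, h1.2.2, h2.2.1, h2.2.2, h]

theorem self_mem_segment_far (α : T.Edge) : α ∈ T.segment (.vertex α.far) := by
  obtain ⟨w, hw⟩ := T.exists_isPath α.near
  have hl : w.length = α.depth := length_eq_dist_of_isPath hw
  refine ⟨w.concat α.adj, hw.concat ?_ _, ?_⟩
  · intro h
    obtain ⟨n, hn, hn'⟩ := SimpleGraph.Walk.mem_support_iff_exists_getVert.1 h
    have h1 := dist_getVert_of_isPath hw hn'
    rw [hn, α.dist_far] at h1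
    omega
  · simp [SimpleGraph.Walk.edges_concat, α.ends_eq]

theorem depth_le_of_mem_edgesBelow {α β : T.Edge} (h : β ∈ T.edgesBelow α) :
    α.depth ≤ β.depth :=
  ((mem_segment_far_iff (self_mem_segment_far β)).1 h).2

theorem succSet_subset_of_mem_edgesBelow {α β : T.Edge} (h : β ∈ T.edgesBelow α) :
    T.succSet β ⊆ T.succSet α :=
  fun _ hx => ((mem_segment_far_iff hx).1 h).1

theorem finite_dist_le (T : PreRootedTree V) (n : ℕ) :
    {v | T.graph.dist T.preRoot v ≤ n}.Finite := by
  induction n with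
  | zero =>
    refine (Set.finite_singleton T.preRoot).subset fun v hv => ?_
    have h : T.graph.dist T.preRoot v = 0 := Nat.le_zero.1 hv
    exact (T.isTree.connected.dist_eq_zero_iff.1 h).symm
  | succ n ih =>
    refine (ih.union (ih.biUnion fun v _ => T.locallyFinite v)).subset fun v hv => ?_
    obtain ⟨w, hw⟩ := T.exists_isPath v
    have hl := length_eq_dist_of_isPath hw
    rcases Nat.lt_or_ge n w.length with h | h
    · refine Or.inr (Set.mem_iUnion₂.2 ⟨w.getVert n, ?_, ?_⟩)
      · exact (dist_getVert_of_isPath hw h.le).le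
      · have := w.adj_getVert_succ h
        rwa [w.getVert_of_length_le (i := n + 1) (hl.trans_le hv)] at this
    · exact Or.inl (hl.symm.trans_le h)

theorem finite_depth_lt (T : PreRootedTree V) (n : ℕ) : {α : T.Edge | α.depth < n}.Finite := by
  have hfin := T.finite_dist_le n
  refine Set.Finite.of_finite_image (f := fun α => (α.near, α.far))
    ((hfin.prod hfin).subset ?_) ?_
  · rintro _ ⟨α, hα, rfl⟩
    exact ⟨le_of_lt (a := α.depth) hα, α.dist_far.trans_le hα⟩
  · intro α _ β _ h
    simp only [Prod.mk.injEq] at h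
    exact Edge.ext_of_ends (by rw [α.ends_eq, β.ends_eq, h.1, h.2])

theorem measurableSet_succSet (α : T.Edge) : MeasurableSet (T.succSet α) :=
  IsOpen.measurableSet (TopologicalSpace.isOpen_generateFrom_of_mem (Or.inl ⟨α, rfl⟩))

end PreRootedTree

/-! ### Real-variable lemmas -/

/-- Telescoping along a finite chain, indexed injectively by `d`. -/
theorem Finset.sum_sub_sum_filter_le_eq {ι : Type*} (A : Finset ι) (d : ι → ℕ)
    (hd : Set.InjOn d A) (f : ι → ℝ) (g : ℝ → ℝ) :
    ∑ i ∈ A, (g (∑ j ∈ A with d j ≤ d i, f j) - g (∑ j ∈ A with d j ≤ d i, f j - f i)) =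
      g (∑ i ∈ A, f i) - g 0 := by
  classical
  induction A using Finset.induction_on_max_value d with
  | empty => simp
  | insert a s ha hmax ih =>
    have hlt : ∀ x ∈ s, d x < d a := fun x hx => lt_of_le_of_ne (hmax x hx) fun h =>
      ha (hd (by simp [hx]) (by simp) h ▸ hx)
    have h1 : ∀ i ∈ s, (insert a s).filter (fun j => d j ≤ d i) =
        s.filter (fun j => d j ≤ d i) := fun i hi => by
      rw [Finset.filter_insert, if_neg (not_le.2 (hlt i hi))]
    have h2 : (insert a s).filter (fun j => d j ≤ d a) = insert a s :=
      Finset.filter_true_of_mem fun x hx => by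
        rcases Finset.mem_insert.1 hx with rfl | hx
        exacts [le_rfl, hmax x hx]
    have h3 : ∑ i ∈ s, (g (∑ j ∈ insert a s with d j ≤ d i, f j) -
        g (∑ j ∈ insert a s with d j ≤ d i, f j - f i)) = g (∑ i ∈ s, f i) - g 0 :=
      (Finset.sum_congr rfl fun i hi => by rw [h1 i hi]).trans (ih (hd.mono (by simp)))
    rw [Finset.sum_insert ha, h2, h3, Finset.sum_insert ha, add_sub_cancel_left]
    ring

theorem Real.rpow_sub_rpow_sub_le {p b c : ℝ} (hp : 1 ≤ p) (hc : 0 ≤ c) (hcb : c ≤ b) :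
    b ^ p - (b - c) ^ p ≤ p * c * b ^ (p - 1) := by
  rcases (hc.trans hcb).eq_or_lt with rfl | hb
  · obtain rfl : c = 0 := le_antisymm hcb hc
    simp
  · have h1 := one_add_mul_self_le_rpow_one_add (s := -(c / b))
      (neg_le_neg ((div_le_one hb).2 hcb)) hp
    have h2 : (b - c) ^ p = b ^ p * (1 + -(c / b)) ^ p := by
      rw [← Real.mul_rpow hb.le (by linarith [(div_le_one hb).2 hcb])]
      congr 1
      field_simp
      ring
    have h3 : b ^ p = b ^ (p - 1) * b := by
      rw [← Real.rpow_add_one hb.ne']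
      ring_nf
    have h4 := mul_le_mul_of_nonneg_left h1 (Real.rpow_nonneg hb.le p)
    rw [h2]
    have h5 : b ^ p * (1 + p * -(c / b)) = b ^ p - p * c * b ^ (p - 1) := by
      rw [h3]
      field_simp
      ring
    linarith

namespace PreRootedTree

variable {V : Type*} {T : PreRootedTree V}

/-! ### The trace inequality for finite sums -/

/-- The truncation `∑_{α ∈ F ∩ [o*, x]} φ(α)` of the Hardy operator to a finite set `F` of
edges. -/
noncomputable def hardySum (F : Finset T.Edge) (φ : T.Edge → ℝ) (x : T.Compactification) : ℝ :=
  ∑ α ∈ F, (T.succSet α).indicator (fun _ => φ α) x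

open Classical in
theorem hardySum_eq (F : Finset T.Edge) (φ : T.Edge → ℝ) (x : T.Compactification) :
    hardySum F φ x = ∑ α ∈ F with α ∈ T.segment x, φ α := by
  rw [hardySum, Finset.sum_filter]
  exact Finset.sum_congr rfl fun α _ => by
    simp only [Set.indicator_apply, succSet, Set.mem_ofPred_eq]

theorem hardySum_eq_sum_indicator (F : Finset T.Edge) (φ : T.Edge → ℝ)
    (x : T.Compactification) : hardySum F φ x = ∑ α ∈ F, (T.segment x).indicator φ α := by
  classical
  rw [hardySum_eq, Finset.sum_filter]
  simp only [Set.indicator_apply]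

theorem hardySum_nonneg {F : Finset T.Edge} {φ : T.Edge → ℝ} (hφ : ∀ α, 0 ≤ φ α)
    (x : T.Compactification) : 0 ≤ hardySum F φ x :=
  Finset.sum_nonneg fun α _ => Set.indicator_nonneg (fun _ _ => hφ α) x

theorem hardySum_mono {F G : Finset T.Edge} {φ : T.Edge → ℝ} (hφ : ∀ α, 0 ≤ φ α) (h : F ⊆ G)
    (x : T.Compactification) : hardySum F φ x ≤ hardySum G φ x :=
  Finset.sum_le_sum_of_subset_of_nonneg h
    fun α _ _ => Set.indicator_nonneg (fun _ _ => hφ α) x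

theorem abs_hardySum_le (F : Finset T.Edge) (φ : T.Edge → ℝ) (x : T.Compactification) :
    |hardySum F φ x| ≤ hardySum F (fun α => |φ α|) x := by
  refine (Finset.abs_sum_le_sum_abs _ _).trans_eq (Finset.sum_congr rfl fun α _ => ?_)
  by_cases hx : x ∈ T.succSet α <;> simp [hx]

/-- Decomposition of `g ∘ hardySum` into its increments along the geodesic. -/
theorem comp_hardySum_eq_sum (F : Finset T.Edge) (φ : T.Edge → ℝ) (g : ℝ → ℝ) (hg : g 0 = 0)
    (x : T.Compactification) :
    g (hardySum F φ x) = ∑ γ ∈ F, (T.succSet γ).indicator (fun _ =>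
      g (hardySum F φ (.vertex γ.far)) - g (hardySum F φ (.vertex γ.far) - φ γ)) x := by
  classical
  have h := Finset.sum_sub_sum_filter_le_eq (F.filter (· ∈ T.segment x)) Edge.depth
    ((depth_injOn_segment x).mono fun α hα => (Finset.mem_filter.1 hα).2) φ g
  rw [← hardySum_eq F φ, hg, sub_zero] at h
  rw [← h, Finset.sum_filter]
  refine Finset.sum_congr rfl fun γ _ => ?_
  by_cases hx : γ ∈ T.segment x
  · have hx' : x ∈ T.succSet γ := hx
    rw [if_pos hx, Set.indicator_of_mem hx', hardySum_eq, Finset.filter_filter]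
    simp only [mem_segment_far_iff hx]
  · have hx' : x ∉ T.succSet γ := hx
    rw [if_neg hx, Set.indicator_of_notMem hx']

theorem memLp_hardySum (F : Finset T.Edge) (φ : T.Edge → ℝ) (μ : Measure T.Compactification)
    [IsFiniteMeasure μ] (p : ℝ≥0∞) : MemLp (hardySum F φ) p μ :=
  memLp_finsetSum _ fun α _ =>
    memLp_indicator_const p (measurableSet_succSet α) _ (Or.inr (measure_ne_top _ _))

/-- The trace inequality: if the energy of `μ` below each edge of `F` is at most `ε` times the
mass, then the truncated Hardy operator has norm at most `p ε^{1/q}`. Writing the `p`-th power of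
`u = hardySum F φ` as the sum of its increments along geodesics turns `∫ u ^ p` into a sum over
edges; Bernoulli's inequality and Hölder's inequality bound it by the norm of `φ` times
`(∑ π^{1-q} μ(S)^q u ^ p)^{1/q}`, and the same increments together with the hypothesis bound
the latter sum by `ε ∫ u ^ p`. -/
theorem integral_hardySum_rpow_le {p q : ℝ} (hpq : p.HolderConjugate q) {π : T.Edge → ℝ}
    (hπ : ∀ α, 0 < π α) (μ : Measure T.Compactification) [IsFiniteMeasure μ]
    (F : Finset T.Edge) {φ : T.Edge → ℝ} (hφ : ∀ α, 0 ≤ φ α) {ε : ℝ} (hε0 : 0 ≤ ε)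
    (hε : ∀ γ ∈ F, ∑ α ∈ F, (T.edgesBelow γ).indicator
      (fun α => π α ^ (1 - q) * μ.real (T.succSet α) ^ q) α ≤ ε * μ.real (T.succSet γ)) :
    (∫ x, hardySum F φ x ^ p ∂μ) ^ (1 / p) ≤
      p * ε ^ (1 / q) * (∑ α ∈ F, φ α ^ p * π α) ^ (1 / p) := by
  classical
  have hp := hpq.pos
  have hq := hpq.symm.pos
  set u : T.Edge → ℝ := fun γ => hardySum F φ (.vertex γ.far) with hu
  set δ : T.Edge → ℝ := fun γ => u γ ^ p - (u γ - φ γ) ^ p with hδ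
  set m : T.Edge → ℝ := fun γ => μ.real (T.succSet γ) with hm
  set a : T.Edge → ℝ := fun α => π α ^ (1 - q) * m α ^ q with ha
  set X : ℝ := ∫ x, hardySum F φ x ^ p ∂μ with hX
  set N : ℝ := ∑ α ∈ F, φ α ^ p * π α with hN
  have hu0 : ∀ γ, 0 ≤ u γ := fun γ => hardySum_nonneg hφ _
  have hm0 : ∀ γ, 0 ≤ m γ := fun γ => measureReal_nonneg
  have hX0 : 0 ≤ X := integral_nonneg fun x => Real.rpow_nonneg (hardySum_nonneg hφ x) p
  have hN0 : 0 ≤ N := Finset.sum_nonneg fun α _ =>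
    mul_nonneg (Real.rpow_nonneg (hφ α) _) (hπ α).le
  have hdec : ∀ x, hardySum F φ x ^ p = ∑ γ ∈ F, (T.succSet γ).indicator (fun _ => δ γ) x :=
    comp_hardySum_eq_sum F φ (· ^ p) (Real.zero_rpow hp.ne')
  have hφu : ∀ γ ∈ F, φ γ ≤ u γ := fun γ hγ => by
    have hmem : Compactification.vertex γ.far ∈ T.succSet γ := self_mem_segment_far γ
    have := Finset.single_le_sum (f := fun α => (T.succSet α).indicator (fun _ => φ α)
      (Compactification.vertex γ.far))
      (fun α _ => Set.indicator_nonneg (fun _ _ => hφ α) _) hγ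
    rwa [Set.indicator_of_mem hmem] at this
  have hδ0 : ∀ γ ∈ F, 0 ≤ δ γ := fun γ hγ => sub_nonneg.2 <|
    Real.rpow_le_rpow (sub_nonneg.2 (hφu γ hγ)) (sub_le_self _ (hφ γ)) hp.le
  have hXsum : X = ∑ γ ∈ F, δ γ * m γ := by
    rw [hX, integral_congr_ae (Eventually.of_forall hdec), integral_finsetSum]
    · refine Finset.sum_congr rfl fun γ _ => ?_
      rw [integral_indicator_const _ (measurableSet_succSet γ), smul_eq_mul, mul_comm]
    · exact fun γ _ => (integrable_const _).indicator (measurableSet_succSet γ)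
  have hcarleson : ∑ α ∈ F, a α * u α ^ p ≤ ε * X := by
    calc ∑ α ∈ F, a α * u α ^ p
        = ∑ α ∈ F, ∑ γ ∈ F, δ γ * (T.edgesBelow γ).indicator a α := by
          refine Finset.sum_congr rfl fun α _ => ?_
          rw [hu]
          simp only
          rw [hdec, Finset.mul_sum]
          refine Finset.sum_congr rfl fun γ _ => ?_
          by_cases h : α ∈ T.edgesBelow γ
          · have h' : Compactification.vertex α.far ∈ T.succSet γ := h
            rw [Set.indicator_of_mem h, Set.indicator_of_mem h', mul_comm]
          · have h' : Compactification.vertex α.far ∉ T.succSet γ := h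
            rw [Set.indicator_of_notMem h, Set.indicator_of_notMem h', mul_zero, mul_zero]
      _ = ∑ γ ∈ F, δ γ * ∑ α ∈ F, (T.edgesBelow γ).indicator a α := by
          rw [Finset.sum_comm]
          exact Finset.sum_congr rfl fun γ _ => (Finset.mul_sum _ _ _).symm
      _ ≤ ∑ γ ∈ F, δ γ * (ε * m γ) :=
          Finset.sum_le_sum fun γ hγ => mul_le_mul_of_nonneg_left (hε γ hγ) (hδ0 γ hγ)
      _ = ε * X := by
          rw [hXsum, Finset.mul_sum]
          exact Finset.sum_congr rfl fun γ _ => by ring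
  have hmain : X ≤ p * (N ^ (1 / p) * (ε * X) ^ (1 / q)) := by
    have hpow : ∀ α, (φ α * π α ^ (1 / p)) ^ p = φ α ^ p * π α := fun α => by
      rw [Real.mul_rpow (hφ α) (Real.rpow_nonneg (hπ α).le _), ← Real.rpow_mul (hπ α).le,
        one_div_mul_cancel hp.ne', Real.rpow_one]
    have hpow' : ∀ α, (π α ^ (-(1 / p)) * m α * u α ^ (p - 1)) ^ q = a α * u α ^ p := fun α => by
      have h1 := Real.rpow_nonneg (hπ α).le (-(1 / p))
      rw [Real.mul_rpow (mul_nonneg h1 (hm0 α)) (Real.rpow_nonneg (hu0 α) _),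
        Real.mul_rpow h1 (hm0 α), ← Real.rpow_mul (hπ α).le, ← Real.rpow_mul (hu0 α),
        hpq.sub_one_mul_conj]
      have : -(1 / p) * q = 1 - q := by
        have := hpq.symm.sub_one_mul_conj
        field_simp
        linarith
      rw [this]
    calc X ≤ ∑ γ ∈ F, p * φ γ * u γ ^ (p - 1) * m γ := by
          rw [hXsum]
          exact Finset.sum_le_sum fun γ hγ => mul_le_mul_of_nonneg_right
            (Real.rpow_sub_rpow_sub_le hpq.lt.le (hφ γ) (hφu γ hγ)) (hm0 γ)
      _ = p * ∑ γ ∈ F, (φ γ * π γ ^ (1 / p)) * (π γ ^ (-(1 / p)) * m γ * u γ ^ (p - 1)) := by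
          rw [Finset.mul_sum]
          refine Finset.sum_congr rfl fun γ _ => ?_
          have : π γ ^ (1 / p) * π γ ^ (-(1 / p)) = 1 := by
            rw [← Real.rpow_add (hπ γ), add_neg_cancel, Real.rpow_zero]
          linear_combination (-p * φ γ * u γ ^ (p - 1) * m γ) * this
      _ ≤ p * (N ^ (1 / p) * (∑ α ∈ F, a α * u α ^ p) ^ (1 / q)) := by
          have := Real.inner_le_Lp_mul_Lq_of_nonneg F hpq
            (f := fun γ => φ γ * π γ ^ (1 / p))
            (g := fun γ => π γ ^ (-(1 / p)) * m γ * u γ ^ (p - 1))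
            (fun γ _ => mul_nonneg (hφ γ) (Real.rpow_nonneg (hπ γ).le _))
            (fun γ _ => mul_nonneg (mul_nonneg (Real.rpow_nonneg (hπ γ).le _) (hm0 γ))
              (Real.rpow_nonneg (hu0 γ) _))
          simp only [hpow, hpow'] at this
          exact mul_le_mul_of_nonneg_left this hp.le
      _ ≤ p * (N ^ (1 / p) * (ε * X) ^ (1 / q)) := by
          have h0 : 0 ≤ ∑ α ∈ F, a α * u α ^ p := Finset.sum_nonneg fun α _ =>
            mul_nonneg (mul_nonneg (Real.rpow_nonneg (hπ α).le _) (Real.rpow_nonneg (hm0 α) _))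
              (Real.rpow_nonneg (hu0 α) _)
          gcongr
  have hsum : 1 / p + 1 / q = 1 := by simpa using hpq.inv_add_inv_eq_one
  rcases hX0.eq_or_lt with h0 | hXpos
  · rw [← h0, Real.zero_rpow (by positivity)]
    positivity
  · have h1 : X ^ (1 / p) * X ^ (1 / q) = X := by
      rw [← Real.rpow_add hXpos, hsum, Real.rpow_one]
    have h2 : 0 < X ^ (1 / q) := Real.rpow_pos_of_pos hXpos _
    rw [Real.mul_rpow hε0 hX0] at hmain
    refine le_of_mul_le_mul_right ?_ h2
    rw [h1]
    linarith

/-! ### The space `ℓ^p(π)` -/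

section EdgeSpace

variable {π : T.Edge → ℝ} {p : ℝ} [hp : Fact (1 < p)]

theorem pos_of_fact (p : ℝ) [hp : Fact (1 < p)] : 0 < p := one_pos.trans hp.out

/-- As the weight is positive, elements of `ℓ^p(π)` are honest functions on edges. -/
theorem ae_edgeMeasure_iff (hπ : ∀ α, 0 < π α) {P : T.Edge → Prop} :
    (∀ᵐ α ∂T.edgeMeasure π, P α) ↔ ∀ α, P α := by
  rw [edgeMeasure, ae_withDensity_iff (Measurable.of_discrete), Measure.ae_count_iff]
  exact forall_congr' fun α => by simp [hπ α]

theorem lintegral_edgeMeasure (f : T.Edge → ℝ≥0∞) :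
    ∫⁻ α, f α ∂T.edgeMeasure π = ∑' α, f α * ENNReal.ofReal (π α) := by
  rw [edgeMeasure, lintegral_withDensity_eq_lintegral_mul _ Measurable.of_discrete
    Measurable.of_discrete, lintegral_count]
  exact tsum_congr fun α => mul_comm _ _

theorem eLpNorm_rpow_edgeMeasure (f : T.Edge → ℝ) :
    eLpNorm f (ENNReal.ofReal p) (T.edgeMeasure π) ^ p =
      ∑' α, ‖f α‖ₑ ^ p * ENNReal.ofReal (π α) := by
  have h0 := pos_of_fact p
  rw [eLpNorm_eq_lintegral_rpow_enorm_toReal (by simpa using h0) ENNReal.ofReal_ne_top,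
    ENNReal.toReal_ofReal h0.le, ← ENNReal.rpow_mul, one_div_mul_cancel h0.ne', ENNReal.rpow_one,
    lintegral_edgeMeasure]

theorem enorm_rpow_mul_ofReal (hπ : ∀ α, 0 < π α) (c : ℝ) (α : T.Edge) :
    ‖c‖ₑ ^ p * ENNReal.ofReal (π α) = ENNReal.ofReal (|c| ^ p * π α) := by
  rw [Real.enorm_eq_ofReal_abs, ENNReal.ofReal_rpow_of_nonneg (abs_nonneg c) (pos_of_fact p).le,
    ENNReal.ofReal_mul' (hπ α).le]

theorem enorm_rpow_eq_tsum (φ : Lp ℝ (ENNReal.ofReal p) (T.edgeMeasure π)) :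
    ‖φ‖ₑ ^ p = ∑' α, ‖φ α‖ₑ ^ p * ENNReal.ofReal (π α) := by
  rw [Lp.enorm_def, eLpNorm_rpow_edgeMeasure]

theorem sum_rpow_mul_le_norm_rpow (hπ : ∀ α, 0 < π α)
    (φ : Lp ℝ (ENNReal.ofReal p) (T.edgeMeasure π)) (F : Finset T.Edge) :
    ∑ α ∈ F, |φ α| ^ p * π α ≤ ‖φ‖ ^ p := by
  have h := ENNReal.sum_le_tsum (f := fun α => ‖φ α‖ₑ ^ p * ENNReal.ofReal (π α)) F
  simp only [enorm_rpow_mul_ofReal hπ] at h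
  rw [← ENNReal.ofReal_sum_of_nonneg
    fun α _ => mul_nonneg (Real.rpow_nonneg (abs_nonneg _) _) (hπ α).le] at h
  simp only [← enorm_rpow_mul_ofReal hπ] at h
  rw [← enorm_rpow_eq_tsum, ← ofReal_norm,
    ENNReal.ofReal_rpow_of_nonneg (norm_nonneg φ) (pos_of_fact p).le] at h
  exact (ENNReal.ofReal_le_ofReal_iff (Real.rpow_nonneg (norm_nonneg φ) _)).1 h

variable (p) in
/-- Evaluation at an edge, as a continuous functional on `ℓ^p(π)`. -/
noncomputable def evalCLM (hπ : ∀ α, 0 < π α) (α : T.Edge) :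
    Lp ℝ (ENNReal.ofReal p) (T.edgeMeasure π) →L[ℝ] ℝ :=
  LinearMap.mkContinuous
    { toFun := fun φ => φ α
      map_add' := fun φ ψ => (ae_edgeMeasure_iff hπ).1 (Lp.coeFn_add φ ψ) α
      map_smul' := fun c φ => (ae_edgeMeasure_iff hπ).1 (Lp.coeFn_smul c φ) α }
    ((π α)⁻¹ ^ (1 / p)) fun φ => by
      have h0 := pos_of_fact p
      have h := sum_rpow_mul_le_norm_rpow hπ φ {α}
      rw [Finset.sum_singleton, ← le_div_iff₀ (hπ α), div_eq_inv_mul] at h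
      have h' := Real.rpow_le_rpow (Real.rpow_nonneg (abs_nonneg _) _) h (one_div_pos.2 h0).le
      rwa [Real.mul_rpow (inv_pos.2 (hπ α)).le (Real.rpow_nonneg (norm_nonneg _) _),
        ← Real.rpow_mul (abs_nonneg _), ← Real.rpow_mul (norm_nonneg _),
        mul_one_div_cancel h0.ne', Real.rpow_one, Real.rpow_one] at h'

@[simp]
theorem evalCLM_apply (hπ : ∀ α, 0 < π α) (α : T.Edge)
    (φ : Lp ℝ (ENNReal.ofReal p) (T.edgeMeasure π)) : evalCLM p hπ α φ = φ α := rfl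

end EdgeSpace

/-! ### Truncated Hardy operators -/

section Truncation

variable {π : T.Edge → ℝ} {p : ℝ} [hp : Fact (1 < p)] {μ : Measure T.Compactification}
  [IsFiniteMeasure μ]

variable (p μ) in
/-- The contribution `φ ↦ φ(α) 1_{S(α)}` of a single edge to the Hardy operator. -/
noncomputable def edgeCLM (hπ : ∀ α, 0 < π α) (α : T.Edge) :
    Lp ℝ (ENNReal.ofReal p) (T.edgeMeasure π) →L[ℝ] Lp ℝ (ENNReal.ofReal p) μ :=
  (evalCLM p hπ α).smulRight
    (indicatorConstLp (ENNReal.ofReal p) (measurableSet_succSet α) (measure_ne_top μ _) (1 : ℝ))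

theorem isCompactOperator_sum_edgeCLM (hπ : ∀ α, 0 < π α) (F : Finset T.Edge) :
    IsCompactOperator ⇑(∑ α ∈ F, edgeCLM p μ hπ α) := by
  classical
  induction F using Finset.induction_on with
  | empty => exact isCompactOperator_zero
  | insert α F hα ih =>
    rw [Finset.sum_insert hα]
    refine IsCompactOperator.add ?_ ih
    have h : IsCompactOperator (evalCLM p hπ α) :=
      isCompactOperator_of_locallyCompactSpace_dom (evalCLM p hπ α)
    exact h.clm_comp (ContinuousLinearMap.smulRight (ContinuousLinearMap.id ℝ ℝ) _)

theorem coeFn_sum_edgeCLM (hπ : ∀ α, 0 < π α) (F : Finset T.Edge)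
    (φ : Lp ℝ (ENNReal.ofReal p) (T.edgeMeasure π)) :
    (∑ α ∈ F, edgeCLM p μ hπ α) φ =ᵐ[μ] hardySum F φ := by
  rw [sum_apply]
  have h : ∀ᵐ x ∂μ, ∀ α ∈ F, edgeCLM p μ hπ α φ x =
      (T.succSet α).indicator (fun _ => φ α) x := by
    refine (ae_ball_iff F.countable_toSet).2 fun α _ => ?_
    filter_upwards [Lp.coeFn_smul (φ α) (indicatorConstLp (ENNReal.ofReal p)
      (measurableSet_succSet α) (measure_ne_top μ _) (1 : ℝ)),
      indicatorConstLp_coeFn (p := ENNReal.ofReal p) (hs := measurableSet_succSet α)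
        (hμs := measure_ne_top μ (T.succSet α)) (c := (1 : ℝ))] with x h1 h2
    refine h1.trans ?_
    rw [Pi.smul_apply, h2]
    by_cases hx : x ∈ T.succSet α <;> simp [hx]
  filter_upwards [h, Lp.coeFn_fun_finsetSum F fun α => edgeCLM p μ hπ α φ] with x h1 h2
  rw [h2, hardySum]
  exact Finset.sum_congr rfl h1

theorem toReal_eLpNorm_hardySum (F : Finset T.Edge) {φ : T.Edge → ℝ}
    (hφ : ∀ α, 0 ≤ φ α) : (eLpNorm (hardySum F φ) (ENNReal.ofReal p) μ).toReal =
      (∫ x, hardySum F φ x ^ p ∂μ) ^ (1 / p) := by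
  rw [(memLp_hardySum F φ μ _).eLpNorm_eq_integral_rpow_norm (by simpa using pos_of_fact p)
    ENNReal.ofReal_ne_top, ENNReal.toReal_ofReal (pos_of_fact p).le, ENNReal.toReal_ofReal
      (Real.rpow_nonneg (integral_nonneg fun x => Real.rpow_nonneg (norm_nonneg _) _) _), one_div]
  simp only [Real.norm_of_nonneg (hardySum_nonneg hφ _)]

theorem norm_sum_edgeCLM_le {q : ℝ} (hpq : p.HolderConjugate q) (hπ : ∀ α, 0 < π α)
    (F : Finset T.Edge) {ε : ℝ} (hε0 : 0 ≤ ε)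
    (hε : ∀ γ ∈ F, ∑ α ∈ F, (T.edgesBelow γ).indicator
      (fun α => π α ^ (1 - q) * μ.real (T.succSet α) ^ q) α ≤ ε * μ.real (T.succSet γ)) :
    ‖∑ α ∈ F, edgeCLM p μ hπ α‖ ≤ p * ε ^ (1 / q) := by
  have h0 := pos_of_fact p
  refine ContinuousLinearMap.opNorm_le_bound _
    (mul_nonneg h0.le (Real.rpow_nonneg hε0 _)) fun φ => ?_
  have hnn : ∀ α, 0 ≤ |φ α| := fun α => abs_nonneg _
  have hle : eLpNorm ((∑ α ∈ F, edgeCLM p μ hπ α) φ) (ENNReal.ofReal p) μ ≤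
      eLpNorm (hardySum F fun α => |φ α|) (ENNReal.ofReal p) μ := by
    rw [eLpNorm_congr_ae (coeFn_sum_edgeCLM hπ F φ)]
    exact eLpNorm_mono_real fun x => abs_hardySum_le F φ x
  have hmem := memLp_hardySum F (fun α => |φ α|) μ (ENNReal.ofReal p)
  rw [Lp.norm_def]
  refine (ENNReal.toReal_mono hmem.eLpNorm_ne_top hle).trans ?_
  rw [toReal_eLpNorm_hardySum F hnn]
  refine (integral_hardySum_rpow_le hpq hπ μ F hnn hε0 hε).trans ?_
  refine mul_le_mul_of_nonneg_left ?_ (mul_nonneg h0.le (Real.rpow_nonneg hε0 _))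
  have h1 := Real.rpow_le_rpow (Finset.sum_nonneg fun α _ =>
    mul_nonneg (Real.rpow_nonneg (hnn α) _) (hπ α).le) (sum_rpow_mul_le_norm_rpow hπ φ F)
    (one_div_pos.2 h0).le
  rwa [← Real.rpow_mul (norm_nonneg _), mul_one_div_cancel h0.ne', Real.rpow_one] at h1

end Truncation

/-! ### Sufficiency -/

/-- A bound on the energy-mass ratio, unfolded to finite sums of real numbers. -/
theorem energyMassRatio_le_ofReal_iff {π : T.Edge → ℝ} {p : ℝ} [hp : Fact (1 < p)]
    (hπ : ∀ α, 0 < π α) (μ : Measure T.Compactification) [IsFiniteMeasure μ] (γ : T.Edge)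
    {ε : ℝ} (hε : 0 ≤ ε) :
    T.energyMassRatio p π μ γ ≤ ENNReal.ofReal ε ↔ ∀ F : Finset T.Edge,
      ∑ α ∈ F, (T.edgesBelow γ).indicator (fun α => π α ^ (1 - p.conjExponent) *
        μ.real (T.succSet α) ^ p.conjExponent) α ≤ ε * μ.real (T.succSet γ) := by
  have hq : 0 ≤ p.conjExponent := (Real.HolderConjugate.conjExponent hp.out).symm.nonneg
  have hnn : ∀ α, 0 ≤ π α ^ (1 - p.conjExponent) * μ.real (T.succSet α) ^ p.conjExponent :=
    fun α => mul_nonneg (Real.rpow_nonneg (hπ α).le _) (Real.rpow_nonneg measureReal_nonneg _)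
  have hterm : ∀ α, ENNReal.ofReal (π α ^ (1 - p.conjExponent)) *
      μ (T.succSet α) ^ p.conjExponent = ENNReal.ofReal
        (π α ^ (1 - p.conjExponent) * μ.real (T.succSet α) ^ p.conjExponent) := fun α => by
    rw [ENNReal.ofReal_mul (Real.rpow_nonneg (hπ α).le _),
      ← ENNReal.ofReal_rpow_of_nonneg measureReal_nonneg hq, ofReal_measureReal]
  rw [energyMassRatio, ENNReal.div_le_iff_le_mul (Or.inr ENNReal.ofReal_ne_top)
    (Or.inl (measure_ne_top _ _)), tsum_subtype (T.edgesBelow γ) fun α =>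
      ENNReal.ofReal (π α ^ (1 - p.conjExponent)) * μ (T.succSet α) ^ p.conjExponent,
    ENNReal.tsum_eq_iSup_sum, iSup_le_iff]
  refine forall_congr' fun F => ?_
  rw [← ofReal_measureReal (μ := μ) (s := T.succSet γ), ← ENNReal.ofReal_mul hε,
    ← ENNReal.ofReal_le_ofReal_iff (mul_nonneg hε measureReal_nonneg),
    ENNReal.ofReal_sum_of_nonneg fun α _ => Set.indicator_nonneg (fun α _ => hnn α) α]
  refine Eq.to_iff (congrArg (· ≤ _) (Finset.sum_congr rfl fun α _ => ?_))
  by_cases h : α ∈ T.edgesBelow γ <;> simp [h, hterm]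

/-- The edge contributions are summable in operator norm, since by the trace inequality the tails
supported at depth at least `n` have norm at most `p ε^{1/p*}`, with `ε` bounding the ratios
there. -/
theorem summable_edgeCLM {π : T.Edge → ℝ} {p : ℝ} [hp : Fact (1 < p)]
    (hπ : ∀ α, 0 < π α) (μ : Measure T.Compactification) [IsFiniteMeasure μ]
    (h : Tendsto (fun n : ℕ => ⨆ (α : T.Edge) (_ : n ≤ α.depth), T.energyMassRatio p π μ α)
      atTop (𝓝 0)) : Summable (edgeCLM p μ hπ) := by
  have hpq := Real.HolderConjugate.conjExponent hp.out
  have h0 := pos_of_fact p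
  have hq := hpq.symm.pos
  rw [summable_iff_vanishing_norm]
  intro η hη
  -- `ε` is chosen so that `p ε^{1/p*} = η / 2`
  set ε : ℝ := (η / (2 * p)) ^ p.conjExponent with hε
  have hε0 : 0 < ε := by positivity
  obtain ⟨n, hn⟩ := (h.eventually_le_const (ENNReal.ofReal_pos.2 hε0)).exists
  refine ⟨(T.finite_depth_lt n).toFinset, fun F hF => ?_⟩
  refine (norm_sum_edgeCLM_le hpq hπ F hε0.le fun γ hγ => ?_).trans_lt ?_
  · refine (energyMassRatio_le_ofReal_iff hπ μ γ hε0.le).1 (le_trans ?_ hn) F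
    have hγn : n ≤ γ.depth := by
      by_contra hlt
      exact Finset.disjoint_left.1 hF hγ (by simpa using hlt)
    exact le_iSup₂ (f := fun (α : T.Edge) (_ : n ≤ α.depth) => T.energyMassRatio p π μ α) γ hγn
  · rw [hε, ← Real.rpow_mul (by positivity), mul_one_div_cancel hq.ne', Real.rpow_one]
    field_simp
    linarith

theorem exists_seq_ae_tendsto_hardySum [Countable V] {π : T.Edge → ℝ} {p : ℝ}
    [hp : Fact (1 < p)] (hπ : ∀ α, 0 < π α) {μ : Measure T.Compactification} [IsFiniteMeasure μ]
    {K : Lp ℝ (ENNReal.ofReal p) (T.edgeMeasure π) →L[ℝ] Lp ℝ (ENNReal.ofReal p) μ}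
    (hK : HasSum (edgeCLM p μ hπ) K) (φ : Lp ℝ (ENNReal.ofReal p) (T.edgeMeasure π)) :
    ∃ F : ℕ → Finset T.Edge, Tendsto F atTop atTop ∧
      ∀ᵐ x ∂μ, Tendsto (fun i => hardySum (F i) φ x) atTop (𝓝 (K φ x)) := by
  have h1 : Tendsto (fun F : Finset T.Edge => (∑ α ∈ F, edgeCLM p μ hπ α) φ) atTop (𝓝 (K φ)) :=
    ((ContinuousLinearMap.apply ℝ _ φ).continuous.tendsto K).comp hK
  obtain ⟨F, hF, hlim⟩ := (tendstoInMeasure_of_tendsto_Lp h1).exists_seq_tendsto_ae'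
  refine ⟨F, hF, ?_⟩
  filter_upwards [hlim, ae_all_iff.2 fun i => coeFn_sum_edgeCLM hπ (μ := μ) (F i) φ]
    with x hx1 hx2
  simpa only [hx2] using hx1

/-- If truncated Hardy operators converge strongly, then the series defining the Hardy operator
converges almost everywhere to the limit. Applied to `|φ|`, the `L^p` convergence bounds the
monotone partial sums, which gives absolute convergence; the sum is then identified along an
almost everywhere convergent subsequence. -/
theorem ae_hasSum_of_hasSum_edgeCLM [Countable V] {π : T.Edge → ℝ} {p : ℝ} [hp : Fact (1 < p)]
    (hπ : ∀ α, 0 < π α) {μ : Measure T.Compactification} [IsFiniteMeasure μ]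
    {K : Lp ℝ (ENNReal.ofReal p) (T.edgeMeasure π) →L[ℝ] Lp ℝ (ENNReal.ofReal p) μ}
    (hK : HasSum (edgeCLM p μ hπ) K) (φ : Lp ℝ (ENNReal.ofReal p) (T.edgeMeasure π)) :
    ∀ᵐ x ∂μ, HasSum (fun α : T.segment x => φ α.1) (K φ x) := by
  obtain ⟨ψ, hψ⟩ : ∃ ψ : Lp ℝ (ENNReal.ofReal p) (T.edgeMeasure π), ∀ α, ψ α = |φ α| :=
    ⟨|φ|, (ae_edgeMeasure_iff hπ).1 (Lp.coeFn_abs φ)⟩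
  obtain ⟨F, hF, hFlim⟩ := exists_seq_ae_tendsto_hardySum hπ hK φ
  obtain ⟨G, hG, hGlim⟩ := exists_seq_ae_tendsto_hardySum hπ hK ψ
  filter_upwards [hFlim, hGlim] with x hx hx'
  have hnn : ∀ α, 0 ≤ ψ α := fun α => (abs_nonneg _).trans_eq (hψ α).symm
  have hsum : Summable ((T.segment x).indicator φ) := by
    refine Summable.of_norm (summable_of_sum_le (c := K ψ x) (fun _ => norm_nonneg _)
      fun s => ?_)
    refine ge_of_tendsto hx' ?_
    filter_upwards [hG.eventually_ge_atTop s] with i hi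
    refine le_trans (le_of_eq ?_) (hardySum_mono hnn hi x)
    rw [hardySum_eq_sum_indicator]
    refine Finset.sum_congr rfl fun α _ => ?_
    by_cases h : α ∈ T.segment x <;> simp [h, hψ]
  have hlim : Tendsto (fun i => ∑ α ∈ F i, (T.segment x).indicator φ α) atTop (𝓝 (K φ x)) := by
    simpa only [hardySum_eq_sum_indicator] using hx
  have h2 : HasSum ((T.segment x).indicator φ) (K φ x) := by
    rw [tendsto_nhds_unique hlim (hsum.hasSum.comp hF)]
    exact hsum.hasSum
  exact (hasSum_subtype_iff_indicator (f := fun α => φ α)).2 h2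

theorem isCompactHardyOperator_of_tendsto [Countable V] {π : T.Edge → ℝ} {p : ℝ}
    [hp : Fact (1 < p)] (hπ : ∀ α, 0 < π α) (μ : Measure T.Compactification) [IsFiniteMeasure μ]
    (h : Tendsto (fun n : ℕ => ⨆ (α : T.Edge) (_ : n ≤ α.depth), T.energyMassRatio p π μ α)
      atTop (𝓝 0)) : T.IsCompactHardyOperator p π μ := by
  have hK := (summable_edgeCLM hπ μ h).hasSum
  exact ⟨_, ae_hasSum_of_hasSum_edgeCLM hπ hK, isCompactOperator_of_tendsto hK
    (Eventually.of_forall fun F => isCompactOperator_sum_edgeCLM hπ F)⟩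

/-! ### Compact operators on `ℓ^p(π)` have small tails -/

section Tails

variable {π : T.Edge → ℝ} {p : ℝ} [hp : Fact (1 < p)]

theorem norm_rpow_eq_sum (hπ : ∀ α, 0 < π α)
    {φ : Lp ℝ (ENNReal.ofReal p) (T.edgeMeasure π)} {G : Finset T.Edge}
    (hG : ∀ α ∉ G, φ α = 0) : ‖φ‖ ^ p = ∑ α ∈ G, |φ α| ^ p * π α := by
  have h0 := pos_of_fact p
  have h := enorm_rpow_eq_tsum φ
  rw [tsum_eq_sum (s := G) fun α hα => by simp [hG α hα, h0]] at h
  simp only [enorm_rpow_mul_ofReal hπ] at h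
  have hnn : ∀ α ∈ G, 0 ≤ |φ α| ^ p * π α :=
    fun α _ => mul_nonneg (Real.rpow_nonneg (abs_nonneg _) _) (hπ α).le
  rw [← ENNReal.ofReal_sum_of_nonneg hnn, ← ofReal_norm,
    ENNReal.ofReal_rpow_of_nonneg (norm_nonneg φ) h0.le] at h
  exact (ENNReal.ofReal_eq_ofReal_iff (Real.rpow_nonneg (norm_nonneg φ) _)
    (Finset.sum_nonneg hnn)).1 h

variable (p) in
theorem exists_Lp_eq_of_finite_support (hπ : ∀ α, 0 < π α) {f : T.Edge → ℝ} {G : Finset T.Edge}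
    (hG : ∀ α ∉ G, f α = 0) :
    ∃ φ : Lp ℝ (ENNReal.ofReal p) (T.edgeMeasure π), ∀ α, φ α = f α := by
  have h0 := pos_of_fact p
  have hmem : MemLp f (ENNReal.ofReal p) (T.edgeMeasure π) := by
    refine ⟨Measurable.of_discrete.aestronglyMeasurable, ?_⟩
    rw [← ENNReal.rpow_lt_top_iff_of_pos h0, eLpNorm_rpow_edgeMeasure,
      tsum_eq_sum (s := G) fun α hα => by simp [hG α hα, h0]]
    exact ENNReal.sum_lt_top.2 fun α _ => ENNReal.mul_lt_top
      (ENNReal.rpow_lt_top_of_nonneg h0.le enorm_ne_top) ENNReal.ofReal_lt_top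
  exact ⟨hmem.toLp f, (ae_edgeMeasure_iff hπ).1 hmem.coeFn_toLp⟩

theorem enorm_sum_rpow_of_disjoint (hπ : ∀ α, 0 < π α) {ι : Type*}
    {φ : ι → Lp ℝ (ENNReal.ofReal p) (T.edgeMeasure π)}
    (hd : ∀ i j, i ≠ j → ∀ α, φ i α = 0 ∨ φ j α = 0) (s : Finset ι) :
    ‖∑ i ∈ s, φ i‖ₑ ^ p = ∑ i ∈ s, ‖φ i‖ₑ ^ p := by
  have h0 := pos_of_fact p
  simp only [enorm_rpow_eq_tsum]
  rw [← Summable.tsum_finsetSum fun _ _ => ENNReal.summable]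
  refine tsum_congr fun α => ?_
  rw [← evalCLM_apply hπ, map_sum, ← Finset.sum_mul]
  simp only [evalCLM_apply]
  congr 1
  by_cases h : ∃ i ∈ s, φ i α ≠ 0
  · obtain ⟨i, hi, hne⟩ := h
    have hz : ∀ j ∈ s, j ≠ i → φ j α = 0 := fun j _ hj => (hd j i hj α).resolve_right hne
    rw [Finset.sum_eq_single_of_mem i hi hz, Finset.sum_eq_single_of_mem i hi
      fun j hj hji => by simp [hz j hj hji, h0]]
  · push Not at h
    rw [Finset.sum_eq_zero h, Finset.sum_eq_zero fun i hi => by simp [h i hi, h0]]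
    simp [h0]

theorem norm_sum_of_disjoint (hπ : ∀ α, 0 < π α) {ι : Type*}
    {φ : ι → Lp ℝ (ENNReal.ofReal p) (T.edgeMeasure π)} (hφ : ∀ i, ‖φ i‖ = 1)
    (hd : ∀ i j, i ≠ j → ∀ α, φ i α = 0 ∨ φ j α = 0) (s : Finset ι) :
    ‖∑ i ∈ s, φ i‖ = (s.card : ℝ) ^ (1 / p) := by
  have h0 := pos_of_fact p
  have h := enorm_sum_rpow_of_disjoint hπ hd s
  have h1 : ∀ i, ‖φ i‖ₑ = 1 := fun i => by rw [← ofReal_norm, hφ, ENNReal.ofReal_one]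
  simp only [h1, ENNReal.one_rpow, Finset.sum_const, nsmul_eq_mul, mul_one] at h
  have h2 := congrArg ENNReal.toReal h
  rw [← ENNReal.toReal_rpow, toReal_enorm, ENNReal.toReal_natCast] at h2
  rw [← h2, ← Real.rpow_mul (norm_nonneg _), mul_one_div_cancel h0.ne', Real.rpow_one]

/-- Normalised disjointly supported functions are weakly null because `p > 1`, so a compact
operator cannot stay bounded away from zero on them: along a subsequence the images would converge
to a nonzero limit, and so would their averages, but an average of `n` of them has norm at most
`‖K‖ n ^ (1 / p - 1)`. -/
theorem exists_norm_apply_le_of_disjoint (hπ : ∀ α, 0 < π α) {E : Type*} [NormedAddCommGroup E]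
    [NormedSpace ℝ E] {K : Lp ℝ (ENNReal.ofReal p) (T.edgeMeasure π) →L[ℝ] E}
    (hK : IsCompactOperator K) {φ : ℕ → Lp ℝ (ENNReal.ofReal p) (T.edgeMeasure π)}
    (hφ : ∀ i, ‖φ i‖ = 1) (hd : ∀ i j, i ≠ j → ∀ α, φ i α = 0 ∨ φ j α = 0) {η : ℝ}
    (hη : 0 < η) : ∃ i, ‖K (φ i)‖ ≤ η := by
  by_contra! hcon
  obtain ⟨C, hC, hsub⟩ := hK.image_closedBall_subset_compact 1
  obtain ⟨a, -, σ, hσ, hlim⟩ := hC.tendsto_subseq (x := fun i => K (φ i)) fun i =>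
    hsub ⟨φ i, by simp [hφ], rfl⟩
  have ha : η ≤ ‖a‖ := ge_of_tendsto hlim.norm (Eventually.of_forall fun i => (hcon _).le)
  have hces := hlim.cesaro_smul
  have hz : Tendsto (fun n : ℕ => (n : ℝ)⁻¹ • ∑ i ∈ Finset.range n, K (φ (σ i))) atTop
      (𝓝 0) := by
    have hexp : 0 < 1 - 1 / p := sub_pos.2 ((div_lt_one (pos_of_fact p)).2 hp.out)
    have hb : Tendsto (fun n : ℕ => ‖K‖ * (n : ℝ) ^ (-(1 - 1 / p))) atTop (𝓝 0) := by
      simpa using ((tendsto_rpow_neg_atTop hexp).comp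
        tendsto_natCast_atTop_atTop).const_mul ‖K‖
    refine squeeze_zero_norm' ?_ hb
    filter_upwards [eventually_gt_atTop 0] with n hn
    have hn' : (0 : ℝ) < n := Nat.cast_pos.2 hn
    have hnorm : ‖∑ i ∈ Finset.range n, φ (σ i)‖ = (n : ℝ) ^ (1 / p) := by
      simpa using norm_sum_of_disjoint hπ (φ := fun i => φ (σ i)) (fun i => hφ _)
        (fun i j hij => hd _ _ (hσ.injective.ne hij)) (Finset.range n)
    rw [← map_sum, norm_smul, norm_inv, Real.norm_of_nonneg hn'.le]
    calc (n : ℝ)⁻¹ * ‖K (∑ i ∈ Finset.range n, φ (σ i))‖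
        ≤ (n : ℝ)⁻¹ * (‖K‖ * (n : ℝ) ^ (1 / p)) := by
          rw [← hnorm]
          exact mul_le_mul_of_nonneg_left (K.le_opNorm _) (inv_pos.2 hn').le
      _ = ‖K‖ * (n : ℝ) ^ (-(1 - 1 / p)) := by
          rw [show -(1 - 1 / p) = 1 / p - 1 by ring, Real.rpow_sub_one hn'.ne']
          ring
  rw [tendsto_nhds_unique hces hz, norm_zero] at ha
  exact absurd ha (not_le.2 hη)

/-- A compact operator is small on finitely supported functions living far away: otherwise one
could choose inductively a normalised disjointly supported sequence on which it is not. -/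
theorem exists_finset_norm_apply_le (hπ : ∀ α, 0 < π α) {E : Type*} [NormedAddCommGroup E]
    [NormedSpace ℝ E] {K : Lp ℝ (ENNReal.ofReal p) (T.edgeMeasure π) →L[ℝ] E}
    (hK : IsCompactOperator K) {η : ℝ} (hη : 0 < η) :
    ∃ F : Finset T.Edge, ∀ (φ : Lp ℝ (ENNReal.ofReal p) (T.edgeMeasure π)) (G : Finset T.Edge),
      Disjoint G F → (∀ α ∉ G, φ α = 0) → ‖K φ‖ ≤ η * ‖φ‖ := by
  classical
  by_contra! hcon
  choose φ G hdisj hsupp hlt using hcon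
  -- `F n` collects the supports chosen before step `n`
  let F : ℕ → Finset T.Edge := fun n => Nat.rec ∅ (fun _ F => F ∪ G F) n
  have hF : ∀ n, F (n + 1) = F n ∪ G (F n) := fun n => rfl
  have hmono : Monotone F := monotone_nat_of_le_succ fun n => by
    rw [hF]
    exact Finset.subset_union_left
  have hpos : ∀ n, 0 < ‖φ (F n)‖ := fun n => norm_pos_iff.2 fun h => by
    have := hlt (F n)
    simp [h] at this
  have hlt' : ∀ i j, i < j → ∀ α, φ (F i) α = 0 ∨ φ (F j) α = 0 := fun i j hij α => by
    by_cases h : α ∈ G (F i)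
    · refine Or.inr (hsupp _ α fun h' => Finset.disjoint_left.1 (hdisj (F j)) h' ?_)
      have : α ∈ F (i + 1) := by
        rw [hF]
        exact Finset.mem_union_right _ h
      exact hmono hij this
    · exact Or.inl (hsupp _ α h)
  have hval : ∀ n α, (‖φ (F n)‖⁻¹ • φ (F n) : Lp ℝ (ENNReal.ofReal p) (T.edgeMeasure π)) α =
      ‖φ (F n)‖⁻¹ * φ (F n) α := fun n α =>
    (evalCLM p hπ α).map_smul ‖φ (F n)‖⁻¹ (φ (F n))
  obtain ⟨i, hi⟩ := exists_norm_apply_le_of_disjoint hπ hK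
    (φ := fun n => ‖φ (F n)‖⁻¹ • φ (F n))
    (fun n => by
      rw [norm_smul, norm_inv, norm_norm, inv_mul_cancel₀ (hpos n).ne'])
    (fun i j hij α => by
      rw [hval, hval]
      rcases lt_or_gt_of_ne hij with h | h
      · exact (hlt' i j h α).imp (fun h => by simp [h]) (fun h => by simp [h])
      · exact (hlt' j i h α).symm.imp (fun h => by simp [h]) (fun h => by simp [h])) hη
  rw [map_smul, norm_smul, norm_inv, norm_norm, inv_mul_le_iff₀ (hpos i), mul_comm] at hi
  exact absurd (hlt (F i)) (not_lt.2 hi)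

end Tails

/-! ### Necessity -/

theorem ae_eq_hardySum_of_hasSum {π : T.Edge → ℝ} {p : ℝ} [hp : Fact (1 < p)]
    {μ : Measure T.Compactification}
    {K : Lp ℝ (ENNReal.ofReal p) (T.edgeMeasure π) →L[ℝ] Lp ℝ (ENNReal.ofReal p) μ}
    (hK : ∀ φ, ∀ᵐ x ∂μ, HasSum (fun α : T.segment x => φ α.1) (K φ x))
    {φ : Lp ℝ (ENNReal.ofReal p) (T.edgeMeasure π)} {G : Finset T.Edge}
    (hG : ∀ α ∉ G, φ α = 0) : K φ =ᵐ[μ] hardySum G φ := by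
  filter_upwards [hK φ] with x hx
  have h1 : HasSum ((T.segment x).indicator fun α => φ α) (K φ x) :=
    (hasSum_subtype_iff_indicator (f := fun α => φ α)).1 hx
  have h2 : HasSum ((T.segment x).indicator fun α => φ α)
      (∑ α ∈ G, (T.segment x).indicator (fun α => φ α) α) :=
    hasSum_sum_of_ne_finset_zero fun α hα =>
      Set.indicator_apply_eq_zero.2 fun _ => hG α hα
  rw [h1.unique h2, hardySum_eq_sum_indicator]

/-- Testing the Hardy operator on the extremal function `(μ(S(α)) / π(α)) ^ (q - 1)` of a finite
set `G` of edges below `γ`. Both the `p`-th power of its norm and the integral of its image over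
`S(γ)` are the energy of `G`, so Hölder's inequality bounds the energy-mass ratio. -/
theorem sum_energy_le_of_norm_apply_le {π : T.Edge → ℝ} {p q : ℝ} [hp : Fact (1 < p)]
    (hpq : p.HolderConjugate q) (hπ : ∀ α, 0 < π α)
    {μ : Measure T.Compactification} [IsFiniteMeasure μ]
    {K : Lp ℝ (ENNReal.ofReal p) (T.edgeMeasure π) →L[ℝ] Lp ℝ (ENNReal.ofReal p) μ}
    (hK : ∀ φ, ∀ᵐ x ∂μ, HasSum (fun α : T.segment x => φ α.1) (K φ x)) {η : ℝ} (hη : 0 ≤ η)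
    {γ : T.Edge} {G : Finset T.Edge} (hGγ : ∀ α ∈ G, α ∈ T.edgesBelow γ)
    (hle : ∀ φ, (∀ α ∉ G, φ α = 0) → ‖K φ‖ ≤ η * ‖φ‖) :
    ∑ α ∈ G, π α ^ (1 - q) * μ.real (T.succSet α) ^ q ≤ η ^ q * μ.real (T.succSet γ) := by
  classical
  have h0 := pos_of_fact p
  have hq := hpq.symm.pos
  set m : T.Edge → ℝ := fun γ => μ.real (T.succSet γ) with hm
  have hm0 : ∀ γ, 0 ≤ m γ := fun γ => measureReal_nonneg
  have hmπ : ∀ α, 0 ≤ m α / π α := fun α => div_nonneg (hm0 α) (hπ α).le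
  set A : ℝ := ∑ α ∈ G, π α ^ (1 - q) * m α ^ q with hA
  have hA0 : 0 ≤ A := Finset.sum_nonneg fun α _ =>
    mul_nonneg (Real.rpow_nonneg (hπ α).le _) (Real.rpow_nonneg (hm0 α) _)
  obtain ⟨φ, hφ⟩ := exists_Lp_eq_of_finite_support p hπ (G := G)
    (f := fun α => if α ∈ G then (m α / π α) ^ (q - 1) else 0) fun α hα => if_neg hα
  have hφG : ∀ α ∉ G, φ α = 0 := fun α hα => (hφ α).trans (if_neg hα)
  have hφG' : ∀ α ∈ G, φ α = (m α / π α) ^ (q - 1) := fun α hα => (hφ α).trans (if_pos hα)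
  have hφ0 : ∀ α, 0 ≤ φ α := fun α => by
    rw [hφ]
    split_ifs
    exacts [Real.rpow_nonneg (hmπ α) _, le_rfl]
  have hnorm : ‖φ‖ ^ p = A := by
    rw [norm_rpow_eq_sum hπ hφG]
    refine Finset.sum_congr rfl fun α hα => ?_
    rw [abs_of_nonneg (hφ0 α), hφG' α hα, ← Real.rpow_mul (hmπ α), hpq.symm.sub_one_mul_conj,
      Real.div_rpow (hm0 α) (hπ α).le, Real.rpow_sub (hπ α), Real.rpow_one]
    ring
  have hint : ∫ x, hardySum G φ x ∂μ = A := by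
    unfold hardySum
    rw [integral_finsetSum _ fun α _ =>
      (integrable_const _).indicator (measurableSet_succSet α)]
    refine Finset.sum_congr rfl fun α hα => ?_
    rw [integral_indicator_const _ (measurableSet_succSet α), smul_eq_mul, hφG' α hα,
      Real.div_rpow (hm0 α) (hπ α).le]
    have h1 : m α ^ q = m α ^ (q - 1) * m α := by
      rw [← Real.rpow_add_one' (hm0 α) (by simpa using hq.ne'), sub_add_cancel]
    have h2 : π α ^ (1 - q) = (π α ^ (q - 1))⁻¹ := by
      rw [← Real.rpow_neg (hπ α).le, neg_sub]
    rw [h1, h2, div_eq_mul_inv]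
    ring
  have hKnorm : ‖K φ‖ = (∫ x, hardySum G φ x ^ p ∂μ) ^ (1 / p) := by
    rw [Lp.norm_def, eLpNorm_congr_ae (ae_eq_hardySum_of_hasSum hK hφG),
      toReal_eLpNorm_hardySum G hφ0]
  have hholder : A ≤ ‖K φ‖ * m γ ^ (1 / q) := by
    have h := integral_mul_le_Lp_mul_Lq_of_nonneg hpq (μ := μ) (f := hardySum G φ)
      (g := (T.succSet γ).indicator fun _ => (1 : ℝ))
      (Eventually.of_forall (hardySum_nonneg hφ0))
      (Eventually.of_forall fun x => Set.indicator_nonneg (fun _ _ => zero_le_one) x)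
      (memLp_hardySum _ _ _ _)
      (memLp_indicator_const _ (measurableSet_succSet γ) _ (Or.inr (measure_ne_top _ _)))
    have h1 : ∀ x, hardySum G φ x * (T.succSet γ).indicator (fun _ => (1 : ℝ)) x =
        hardySum G φ x := fun x => by
      by_cases hx : x ∈ T.succSet γ
      · rw [Set.indicator_of_mem hx, mul_one]
      · rw [Set.indicator_of_notMem hx, mul_zero, hardySum, Finset.sum_eq_zero]
        exact fun α hα => Set.indicator_of_notMem
          (fun h => hx (succSet_subset_of_mem_edgesBelow (hGγ α hα) h)) _
    have h2 : ∀ x, (T.succSet γ).indicator (fun _ => (1 : ℝ)) x ^ q =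
        (T.succSet γ).indicator (fun _ => (1 : ℝ)) x := fun x => by
      by_cases hx : x ∈ T.succSet γ <;> simp [hx, hq.ne']
    simp only [h1, h2] at h
    rw [hint, ← hKnorm, integral_indicator_const _ (measurableSet_succSet γ), smul_eq_mul,
      mul_one] at h
    exact h
  have hφA : ‖φ‖ = A ^ (1 / p) := by
    rw [← hnorm, ← Real.rpow_mul (norm_nonneg _), mul_one_div_cancel h0.ne', Real.rpow_one]
  rcases hA0.eq_or_lt with hA0 | hApos
  · rw [← hA0]
    exact mul_nonneg (Real.rpow_nonneg hη _) (hm0 γ)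
  · have h1 : A ^ (1 / q) * A ^ (1 / p) = A := by
      have hsum : 1 / q + 1 / p = 1 := by simpa using hpq.symm.inv_add_inv_eq_one
      rw [← Real.rpow_add hApos, hsum, Real.rpow_one]
    have h2 : A ^ (1 / q) ≤ η * m γ ^ (1 / q) := by
      refine le_of_mul_le_mul_right ?_ (Real.rpow_pos_of_pos hApos (1 / p))
      rw [h1]
      have := mul_le_mul_of_nonneg_right (hle φ hφG) (Real.rpow_nonneg (hm0 γ) (1 / q))
      rw [hφA] at this
      linarith
    have h3 := Real.rpow_le_rpow (Real.rpow_nonneg hA0 _) h2 hq.le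
    rwa [Real.mul_rpow hη (Real.rpow_nonneg (hm0 γ) _), ← Real.rpow_mul hA0,
      ← Real.rpow_mul (hm0 γ), one_div_mul_cancel hq.ne', Real.rpow_one, Real.rpow_one] at h3

theorem tendsto_of_isCompactHardyOperator {π : T.Edge → ℝ} {p : ℝ} [hp : Fact (1 < p)]
    (hπ : ∀ α, 0 < π α) {μ : Measure T.Compactification} [IsFiniteMeasure μ]
    (h : T.IsCompactHardyOperator p π μ) :
    Tendsto (fun n : ℕ => ⨆ (α : T.Edge) (_ : n ≤ α.depth), T.energyMassRatio p π μ α)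
      atTop (𝓝 0) := by
  classical
  obtain ⟨K, hK, hcomp⟩ := h
  have hpq := Real.HolderConjugate.conjExponent hp.out
  have hq := hpq.symm.pos
  rw [ENNReal.tendsto_nhds_zero]
  intro ε hε
  obtain ⟨r, hr0, hrε⟩ := ENNReal.lt_iff_exists_nnreal_btwn.1 hε
  have hr : (0 : ℝ) < r := by simpa using hr0
  obtain ⟨F, hF⟩ := exists_finset_norm_apply_le hπ hcomp
    (Real.rpow_pos_of_pos hr (1 / p.conjExponent))
  filter_upwards [eventually_gt_atTop (F.sup Edge.depth)] with n hn
  refine le_trans (iSup₂_le fun γ hγ => ?_) hrε.le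
  rw [← ENNReal.ofReal_coe_nnreal, energyMassRatio_le_ofReal_iff hπ μ γ hr.le]
  intro G
  have hsum := sum_energy_le_of_norm_apply_le hpq hπ hK (Real.rpow_nonneg hr.le _) (γ := γ)
    (G := G.filter (· ∈ T.edgesBelow γ)) (fun α hα => (Finset.mem_filter.1 hα).2)
    fun φ hφ => hF φ _ (Finset.disjoint_left.2 fun α hα hαF => by
      have h1 := depth_le_of_mem_edgesBelow (Finset.mem_filter.1 hα).2
      have h2 := Finset.le_sup (f := Edge.depth) hαF
      omega) hφ
  rw [← Real.rpow_mul hr.le, one_div_mul_cancel hq.ne', Real.rpow_one, Finset.sum_filter] at hsum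
  simpa only [Set.indicator_apply] using hsum

end PreRootedTree

theorem mainTheorem9 {V : Type*} [Countable V] (T : PreRootedTree V) (p : ℝ) [Fact (1 < p)]
    (π : T.Edge → ℝ) (hπ : ∀ α, 0 < π α)
    (μ : Measure T.Compactification) [IsFiniteMeasure μ] :
    T.IsCompactHardyOperator p π μ ↔
      Tendsto (fun n : ℕ => ⨆ (α : T.Edge) (_ : n ≤ α.depth), T.energyMassRatio p π μ α)
        atTop (𝓝 0) :=
  ⟨PreRootedTree.tendsto_of_isCompactHardyOperator hπ,
    PreRootedTree.isCompactHardyOperator_of_tendsto hπ μ⟩
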